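/- Let $\mathcal F^2$ be the Fock space, i.e. the space of all entire functions $f:\mathbb C\to\mathbb C$ that are square integrable with respect to $d\mu(z)=\pi^{-1}e^{-|z|^2}\,dA(z)$ ($dA$ being Lebesgue measure on $\mathbb C$), with inner product $\langle f,g\rangle=\int_{\mathbb C} f\,\overline g\,d\mu$. Let $\psi$ be an entire function and let $\varphi(z)=az+b$, where $a,b\in\mathbb C$ and $0<|a|<1$. Suppose that $\psi\left(\frac{b}{1-a}\right)\neq 0$ and that the weighted composition operator $C_{\psi,\varphi}h=\psi\cdot(h\circ\varphi)$ maps $\mathcal F^2$ into itself and is a compact operator on $\mathcal F^2$. If $a$ is not a positive real number, then the numerical range $$W(C_{\psi,\varphi})=\{\langle C_{\psi,\varphi}f,f\rangle : f\in\mathcal F^2,\ \|f\|=1\}$$ contains $0$ and is a closed subset of $\mathbb C$. -/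

import Mathlib

open MeasureTheory

noncomputable section

/-- The Gaussian measure `dμ(z) = π⁻¹ exp (-|z|²) dA(z)` on `ℂ`, with `dA` the Lebesgue measure. -/
def fockMeasure : Measure ℂ :=
  (volume : Measure ℂ).withDensity fun z => ENNReal.ofReal (Real.pi⁻¹ * Real.exp (-‖z‖ ^ 2))

/-- The entire functions that are square integrable with respect to `fockMeasure`, as a linear
subspace of all functions `ℂ → ℂ`. -/
def fockSubmodule : Submodule ℂ (ℂ → ℂ) where
  carrier := {f | Differentiable ℂ f ∧ MemLp f 2 fockMeasure}
  add_mem' hf hg := ⟨hf.1.add hg.1, hf.2.add hg.2⟩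
  zero_mem' := ⟨differentiable_const 0, MemLp.zero⟩
  smul_mem' c _ hf := ⟨hf.1.const_smul c, hf.2.const_smul c⟩

/-- The Fock space `F²`. It is a type of its own, so that it carries the topology of its inner
product and not the topology of pointwise convergence of `ℂ → ℂ`. -/
def FockSpace : Type := fockSubmodule

namespace FockSpace

instance : AddCommGroup FockSpace := inferInstanceAs (AddCommGroup fockSubmodule)

instance : Module ℂ FockSpace := inferInstanceAs (Module ℂ fockSubmodule)

instance : FunLike FockSpace ℂ ℂ where
  coe f := Subtype.val f
  coe_injective _ _ h := Subtype.ext h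

/-- An entire square integrable function, as an element of the Fock space. -/
def mk (f : ℂ → ℂ) (hf : Differentiable ℂ f ∧ MemLp f 2 fockMeasure) : FockSpace := ⟨f, hf⟩

@[simp] lemma mk_apply (f : ℂ → ℂ) (hf : Differentiable ℂ f ∧ MemLp f 2 fockMeasure) (z : ℂ) :
    mk f hf z = f z := rfl

@[simp] lemma zero_apply (z : ℂ) : (0 : FockSpace) z = 0 := rfl

@[simp] lemma add_apply (f g : FockSpace) (z : ℂ) : (f + g) z = f z + g z := rfl

@[simp] lemma smul_apply (c : ℂ) (f : FockSpace) (z : ℂ) : (c • f) z = c * f z := rfl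

@[ext] lemma ext {f g : FockSpace} (h : ∀ z, f z = g z) : f = g := DFunLike.ext f g h

lemma differentiable (f : FockSpace) : Differentiable ℂ f := f.2.1

lemma memLp (f : FockSpace) : MemLp f 2 fockMeasure := f.2.2

lemma integrable_inner (f g : FockSpace) :
    Integrable (fun z => g z * (starRingEnd ℂ) (f z)) fockMeasure :=
  MemLp.integrable_mul (p := 2) (q := 2) g.memLp f.memLp.star

lemma volume_absolutelyContinuous : (volume : Measure ℂ) ≪ fockMeasure := by
  refine withDensity_absolutelyContinuous' (by fun_prop) (Filter.Eventually.of_forall fun z => ?_)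
  have : 0 < Real.pi⁻¹ * Real.exp (-‖z‖ ^ 2) := by positivity
  simpa using this

/-- The inner product of the Fock space. In Mathlib's convention the first argument is the
conjugate-linear one, so `inner ℂ f g = ∫ g * conj f dμ` is what is usually written `⟨g, f⟩`. -/
@[reducible]
def innerCore : InnerProductSpace.Core ℂ FockSpace where
  inner f g := ∫ z, g z * (starRingEnd ℂ) (f z) ∂fockMeasure
  conj_inner_symm f g := by
    rw [← integral_conj]
    simp [mul_comm]
  re_inner_nonneg f := by
    have : ∀ z, f z * (starRingEnd ℂ) (f z) = ((‖f z‖ ^ 2 : ℝ) : ℂ) := fun z => by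
      rw [Complex.mul_conj']; push_cast; rfl
    simp only [this]
    rw [integral_complex_ofReal]
    simpa using integral_nonneg fun z => sq_nonneg ‖f z‖
  add_left f g h := by
    rw [← integral_add (integrable_inner f h) (integrable_inner g h)]
    simp [mul_add]
  smul_left f g c := by
    rw [← integral_const_mul]
    simp [mul_left_comm]
  definite f hf := by
    have hsq : ∀ z, f z * (starRingEnd ℂ) (f z) = ((‖f z‖ ^ 2 : ℝ) : ℂ) := fun z => by
      rw [Complex.mul_conj']; push_cast; rfl
    have hint : Integrable (fun z => ‖f z‖ ^ 2) fockMeasure := by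
      have := (integrable_inner f f).norm
      refine this.congr (Filter.Eventually.of_forall fun z => ?_)
      simp [sq]
    simp only [hsq] at hf
    rw [integral_complex_ofReal] at hf
    have h0 : ∫ z, ‖f z‖ ^ 2 ∂fockMeasure = 0 := by exact_mod_cast hf
    rw [integral_eq_zero_iff_of_nonneg (fun z => sq_nonneg ‖f z‖) hint] at h0
    have h1 := volume_absolutelyContinuous.ae_eq h0
    have h2 := Continuous.ae_eq_iff_eq (volume : Measure ℂ)
      (f.differentiable.continuous.norm.pow 2) continuous_const |>.1 h1
    ext z
    have h3 : ‖f z‖ ^ 2 = 0 := congrFun h2 z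
    simpa using h3

instance : NormedAddCommGroup FockSpace := innerCore.toNormedAddCommGroup

instance : InnerProductSpace ℂ FockSpace := InnerProductSpace.ofCore innerCore.toCore

lemma inner_def (f g : FockSpace) :
    inner ℂ f g = ∫ z, g z * (starRingEnd ℂ) (f z) ∂fockMeasure := rfl

end FockSpace

/-- `C_{ψ,φ}` acts on the Fock space: `ψ · (h ∘ φ)` is in `F²` for every `h` in `F²`. -/
def MapsFock (ψ φ : ℂ → ℂ) : Prop :=
  ∀ h : FockSpace, (Differentiable ℂ fun z => ψ z * h (φ z)) ∧
    MemLp (fun z => ψ z * h (φ z)) 2 fockMeasure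

/-- The weighted composition operator `C_{ψ,φ} h = ψ · (h ∘ φ)` on the Fock space. -/
def weightedComp (ψ φ : ℂ → ℂ) (hm : MapsFock ψ φ) : FockSpace →ₗ[ℂ] FockSpace where
  toFun h := FockSpace.mk (fun z => ψ z * h (φ z)) (hm h)
  map_add' f g := by ext z; simp [mul_add]
  map_smul' c f := by ext z; simp [mul_left_comm]

/-- The numerical range `W(T) = {⟨T f, f⟩ : ‖f‖ = 1}`; Mathlib's inner product is linear in its
second argument. -/
def numericalRange {E : Type*} [NormedAddCommGroup E] [InnerProductSpace ℂ E] (T : E →ₗ[ℂ] E) :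
    Set ℂ :=
  {w | ∃ f : E, ‖f‖ = 1 ∧ w = inner ℂ f (T f)}

end

/-! Let `p = b / (1 - a)`, the fixed point of `φ`. On the translated monomial `(z - p) ^ m * exp (p̄
z)` the operator yields a function vanishing to order `m` at `p`, whose pairing with that monomial
sees only the leading coefficient (`inner_monomial`). Hence `ψ p * a ^ m` is in `W` for every `m`.
As `W` is convex (`convex_numericalRange`) and `0` is a convex combination of powers of a
non-positive `a` (`exists_pow_convex_relation`), `0 ∈ W`. Closedness: compactness makes the
quadratic form weakly continuous on the unit ball, so a limit of values is `⟨T x, x⟩` with `‖x‖ ≤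
1`. If nonzero, it lies on the segment from `0` to a point of `W`. -/

noncomputable section

/-! ### Numerical ranges: convexity, and closedness for compact operators. -/

section NumericalRange

open Filter Topology ComplexConjugate

variable {E : Type*} [NormedAddCommGroup E] [InnerProductSpace ℂ E]

lemma inner_self_eq_ofReal_norm_sq (x : E) : inner ℂ x x = (‖x‖ : ℂ) ^ 2 :=
  inner_self_eq_norm_sq_to_K x

lemma inner_map_div_norm_sq_mem_numericalRange (T : E →ₗ[ℂ] E) {x : E} (hx : x ≠ 0) :
    inner ℂ x (T x) / (‖x‖ : ℂ) ^ 2 ∈ numericalRange T := by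
  have hn : (‖x‖ : ℂ) ≠ 0 := by simpa using hx
  refine ⟨((‖x‖ : ℂ)⁻¹) • x, ?_, ?_⟩
  · rw [norm_smul, norm_inv, Complex.norm_real, norm_norm, inv_mul_cancel₀ (by simpa using hx)]
  · rw [map_smul, inner_smul_left, inner_smul_right, map_inv₀, Complex.conj_ofReal]
    field_simp

lemma exists_norm_eq_one_mul_im_eq_zero (d : ℂ) : ∃ c : ℂ, ‖c‖ = 1 ∧ (c * d).im = 0 := by
  by_cases hd : d = 0
  · exact ⟨1, by simp, by simp [hd]⟩
  · have hn : ‖d‖ ≠ 0 := by simpa using hd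
    refine ⟨conj d / ‖d‖, by simp [hn], ?_⟩
    have : conj d / ‖d‖ * d = ((‖d‖ : ℝ) : ℂ) := by
      rw [div_mul_eq_mul_div, Complex.conj_mul', div_eq_iff (by simpa using hd)]
      ring
    rw [this, Complex.ofReal_im]

/-- The numerical range of an operator that takes the values `0` and `1` at two unit vectors
contains the unit interval. -/
lemma ofReal_mem_numericalRange_of_zero_of_one (S : E →ₗ[ℂ] E)
    (h0 : (0 : ℂ) ∈ numericalRange S) (h1 : (1 : ℂ) ∈ numericalRange S)
    {s : ℝ} (hs0 : 0 ≤ s) (hs1 : s ≤ 1) : (s : ℂ) ∈ numericalRange S := by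
  obtain ⟨f, hf, hf0⟩ := h0
  obtain ⟨g, hg, hg1⟩ := h1
  -- The phase `c` makes the cross terms of the form real along the segment from `c • f` to `g`.
  obtain ⟨c, hc, hcd⟩ :=
    exists_norm_eq_one_mul_im_eq_zero (inner ℂ g (S f) - conj (inner ℂ f (S g)))
  have hcc : c * conj c = 1 := by rw [Complex.mul_conj', hc]; simp
  set h : ℝ → E := fun t => ((1 - t : ℝ) : ℂ) • c • f + (t : ℂ) • g with hh
  set q : ℝ → ℂ := fun t => inner ℂ (h t) (S (h t)) with hq
  have hqt : ∀ t : ℝ, q t = (t : ℂ) ^ 2 + ((1 - t : ℝ) : ℂ) * t *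
      (conj c * inner ℂ f (S g) + c * inner ℂ g (S f)) := by
    intro t
    simp only [hq, hh, map_add, map_smul, inner_add_left, inner_add_right, inner_smul_left,
      inner_smul_right, ← hf0, ← hg1, Complex.conj_ofReal]
    ring
  have hqim : ∀ t, (q t).im = 0 := by
    have : (conj c * inner ℂ f (S g) + c * inner ℂ g (S f)).im = 0 := by
      rw [← hcd]
      simp only [Complex.add_im, Complex.mul_im, Complex.conj_re, Complex.conj_im, Complex.sub_re,
        Complex.sub_im]
      ring
    intro t
    rw [hqt, Complex.add_im, ← Complex.ofReal_mul, Complex.im_ofReal_mul, this,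
      ← Complex.ofReal_pow, Complex.ofReal_im, mul_zero, add_zero]
  -- The form is `0` on multiples of `f` and `t ^ 2` at `t • g`, so `h t = 0` forces `t = 0`, and
  -- then `c • f = 0`.
  have hhne : ∀ t, h t ≠ 0 := by
    intro t ht
    have e1 : (t : ℂ) • g = -(((1 - t : ℝ) : ℂ) • c • f) := by
      rw [eq_neg_iff_add_eq_zero, add_comm]; exact ht
    have e2 := congrArg (fun x => inner ℂ x (S x)) e1
    simp only [map_neg, map_smul, inner_neg_left, inner_neg_right, inner_smul_left,
      inner_smul_right, ← hf0, ← hg1, Complex.conj_ofReal] at e2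
    have ht0 : t = 0 := by simpa using e2
    have e3 : c • f = 0 := by simpa [hh, ht0] using ht
    have : ‖c • f‖ = 1 := by rw [norm_smul, hc, hf, one_mul]
    rw [e3] at this; simp at this
  have hhc : Continuous h := by fun_prop
  have hqc : Continuous q := by
    have : q = fun t : ℝ => (t : ℂ) ^ 2 + ((1 - t : ℝ) : ℂ) * t *
      (conj c * inner ℂ f (S g) + c * inner ℂ g (S f)) := funext hqt
    rw [this]; fun_prop
  have hrc : Continuous fun t => (q t).re / ‖h t‖ ^ 2 :=
    (Complex.continuous_re.comp hqc).div (by fun_prop) fun t => by simpa using hhne t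
  have hv := intermediate_value_Icc (zero_le_one' ℝ) hrc.continuousOn
  have hr0 : (q 0).re / ‖h 0‖ ^ 2 = 0 := by simp [hqt]
  have hr1 : (q 1).re / ‖h 1‖ ^ 2 = 1 := by simp [hqt, hh, hg]
  rw [hr0, hr1] at hv
  obtain ⟨t, -, ht⟩ := hv ⟨hs0, hs1⟩
  have := inner_map_div_norm_sq_mem_numericalRange S (hhne t)
  convert this using 1
  change _ = q t / _
  rw [← ht, Complex.ofReal_div, Complex.ofReal_pow]
  congr 1
  apply Complex.ext <;> simp [hqim]

/-- Affine normalization: moves two given values of the form to `0` and `1`. -/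
lemma mem_numericalRange_smul_sub_iff (T : E →ₗ[ℂ] E) {k : ℂ} (hk : k ≠ 0) (α w : ℂ) :
    k * (w - α) ∈ numericalRange (k • (T - α • LinearMap.id)) ↔ w ∈ numericalRange T := by
  refine exists_congr fun f => and_congr_right fun hf => ?_
  simp only [LinearMap.smul_apply, LinearMap.sub_apply, LinearMap.id_apply, inner_smul_right,
    inner_sub_right, inner_self_eq_norm_sq_to_K, hf]
  simp [hk]

/-- The **Toeplitz–Hausdorff theorem**. -/
theorem convex_numericalRange (T : E →ₗ[ℂ] E) : Convex ℝ (numericalRange T) := by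
  rw [convex_iff_forall_pos]
  intro α hα β hβ r s hr hs hrs
  by_cases hne : β - α = 0
  · rw [sub_eq_zero.1 hne, ← add_smul, hrs, one_smul]; exact hα
  · have hk := inv_ne_zero hne
    rw [← mem_numericalRange_smul_sub_iff T hk α]
    have h0 := (mem_numericalRange_smul_sub_iff T hk α α).2 hα
    have h1 := (mem_numericalRange_smul_sub_iff T hk α β).2 hβ
    rw [sub_self, mul_zero] at h0
    rw [inv_mul_cancel₀ hne] at h1
    convert ofReal_mem_numericalRange_of_zero_of_one _ h0 h1 hs.le (by linarith) using 1
    have : (r : ℂ) = 1 - s := by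
      rw [eq_sub_iff_add_eq]; exact_mod_cast hrs
    simp only [Complex.real_smul, this]
    field_simp
    ring

/-- If the numerical range of a compact operator on a Hilbert space contains `0`, it is closed. -/
theorem IsCompactOperator.isClosed_numericalRange [CompleteSpace E] {T : E →ₗ[ℂ] E}
    (hT : IsCompactOperator T) (h0 : (0 : ℂ) ∈ numericalRange T) :
    IsClosed (numericalRange T) := by
  refine isClosed_of_closure_subset fun w hw => ?_
  by_cases hw0 : w = 0
  · rwa [hw0]
  obtain ⟨v, hvW, hvw⟩ := mem_closure_iff_seq_limit.1 hw
  choose f hf hfv using hvW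
  have hlim : Tendsto (fun n => inner ℂ (f n) (T (f n))) (hyperfilter ℕ : Filter ℕ) (𝓝 w) := by
    simp only [← hfv]
    exact hvw.mono_left Nat.hyperfilter_le_atTop
  obtain ⟨K, hK, hKf⟩ := hT.image_closedBall_subset_compact 1
  obtain ⟨y, -, hy⟩ := hK.ultrafilter_le_nhds ((hyperfilter ℕ).map fun n => T (f n)) (by
    rw [le_principal_iff, Ultrafilter.mem_coe, Ultrafilter.mem_map]
    exact univ_mem' fun n => hKf ⟨f n, by simp [hf], rfl⟩)
  -- Banach–Alaoglu through the Riesz isomorphism; an ultrafilter replaces subsequences, so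
  -- separability is not needed.
  obtain ⟨l, hl, hfl⟩ := (WeakDual.isCompact_closedBall (𝕜 := ℂ) (E := E) 0 1).ultrafilter_le_nhds
    ((hyperfilter ℕ).map fun n => StrongDual.toWeakDual (InnerProductSpace.toDual ℂ E (f n))) (by
      rw [le_principal_iff, Ultrafilter.mem_coe, Ultrafilter.mem_map]
      refine univ_mem' fun n => ?_
      simp [hf])
  obtain ⟨x, hx⟩ := (InnerProductSpace.toDual ℂ E).surjective (WeakDual.toStrongDual l)
  have hx1 : ‖x‖ ≤ 1 := by
    have : ‖WeakDual.toStrongDual l‖ ≤ 1 := by simpa using hl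
    rwa [← hx, LinearIsometryEquiv.norm_map] at this
  have hxl : ∀ u, l u = inner ℂ x u := fun u => by
    have := congrArg (fun m => m u) hx
    simpa using this.symm
  have hweak : ∀ u, Tendsto (fun n => inner ℂ (f n) u) (hyperfilter ℕ : Filter ℕ)
      (𝓝 (inner ℂ x u)) := fun u => by
    rw [← hxl]
    exact ((WeakDual.eval_continuous u).tendsto l).comp hfl
  have hTy : Tendsto (fun n => T (f n)) (hyperfilter ℕ : Filter ℕ) (𝓝 y) := hy
  have hyx : y = T x := by
    let A : E →L[ℂ] E := ⟨T, hT.continuous⟩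
    refine ext_inner_right ℂ fun u => ?_
    refine tendsto_nhds_unique (hTy.inner (tendsto_const_nhds (x := u))) ?_
    have := hweak (ContinuousLinearMap.adjoint A u)
    simp only [ContinuousLinearMap.adjoint_inner_right] at this
    exact this
  have hlim' : Tendsto (fun n => inner ℂ (f n) (T (f n))) (hyperfilter ℕ : Filter ℕ)
      (𝓝 (inner ℂ x y)) := by
    have h1 : Tendsto (fun n => inner ℂ (f n) (T (f n) - y)) (hyperfilter ℕ : Filter ℕ)
        (𝓝 0) := by
      refine squeeze_zero_norm (a := fun n => ‖T (f n) - y‖) (fun n => ?_) ?_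
      · refine (norm_inner_le_norm _ _).trans ?_
        rw [hf, one_mul]
      · simpa using (hTy.sub_const y).norm
    simpa [← inner_add_right] using h1.add (hweak y)
  have hwx : w = inner ℂ x (T x) := hyx ▸ tendsto_nhds_unique hlim hlim'
  have hx0 : x ≠ 0 := by rintro rfl; simp [hwx] at hw0
  have hn : (‖x‖ : ℂ) ≠ 0 := by simpa using hx0
  have hmem := inner_map_div_norm_sq_mem_numericalRange T hx0
  -- The weak limit may have norm below `1`; scaling by `‖x‖ ^ 2` towards `0` stays in the convex
  -- set.
  have := (convex_numericalRange T).smul_mem_of_zero_mem h0 hmem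
    (t := ‖x‖ ^ 2) ⟨by positivity, pow_le_one₀ (norm_nonneg x) hx1⟩
  convert this using 1
  rw [hwx, Complex.real_smul]
  push_cast
  field_simp

end NumericalRange

/-! ### Zero as a convex combination of powers. -/

section Powers

/-- A nonreal number in the upper half plane has a power that is not in it. -/
lemma exists_im_pow_nonpos {a : ℂ} (ha : 0 < a.im) : ∃ n : ℕ, 0 < n ∧ (a ^ n).im ≤ 0 := by
  have h0 : 0 < a.arg := (Complex.arg_nonneg_iff.2 ha.le).lt_of_ne fun h =>
    ha.ne' (Complex.arg_eq_zero_iff.1 h.symm).2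
  have hpi := Complex.arg_le_pi a
  -- The steps `arg a ≤ π` cannot jump over `[π, 2π]`, where the sine is nonpositive.
  set n := ⌈Real.pi / a.arg⌉₊ with hn
  have hl : Real.pi ≤ n * a.arg := by
    rw [← div_le_iff₀ h0]; exact Nat.le_ceil _
  have hu : n * a.arg < Real.pi + a.arg := by
    have := Nat.ceil_lt_add_one (div_nonneg Real.pi_pos.le h0.le)
    rw [← hn] at this
    calc n * a.arg < (Real.pi / a.arg + 1) * a.arg := by gcongr
      _ = _ := by field_simp
  refine ⟨n, Nat.ceil_pos.2 (div_pos Real.pi_pos h0), ?_⟩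
  have : a ^ n = ((‖a‖ ^ n : ℝ) : ℂ) * Complex.exp ((n * a.arg : ℝ) * Complex.I) := by
    conv_lhs => rw [← Complex.norm_mul_exp_arg_mul_I a]
    rw [mul_pow, ← Complex.exp_nat_mul]
    push_cast
    ring_nf
  rw [this, Complex.im_ofReal_mul, Complex.exp_ofReal_mul_I_im]
  refine mul_nonpos_of_nonneg_of_nonpos (by positivity) ?_
  rw [← Real.sin_sub_two_pi]
  exact Real.sin_nonpos_of_nonpos_of_neg_pi_le (by linarith) (by linarith)

lemma exists_pow_convex_relation_of_im_pos {a : ℂ} (ha : 0 < a.im) :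
    ∃ (n : ℕ) (c₀ c₁ c₂ : ℝ), 0 ≤ c₀ ∧ 0 ≤ c₁ ∧ 0 ≤ c₂ ∧ 0 < c₀ + c₁ + c₂ ∧
      (c₀ : ℂ) + c₁ * a ^ n + c₂ * a ^ (n + 1) = 0 := by
  classical
  have hex := exists_im_pow_nonpos ha
  have hsp := Nat.find_spec hex
  obtain ⟨n, hn⟩ : ∃ n, Nat.find hex = n + 1 := Nat.exists_eq_succ_of_ne_zero hsp.1.ne'
  rw [hn] at hsp
  have hn0 : n ≠ 0 := by
    rintro rfl
    simp at hsp; linarith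
  have hpos : 0 < (a ^ n).im := by
    have := Nat.find_min hex (m := n) (by omega)
    push Not at this
    exact this (Nat.pos_of_ne_zero hn0)
  set w := a ^ n with hw
  have hsucc : a ^ (n + 1) = w * a := pow_succ a n
  rw [hsucc] at hsp
  have hc0 : 0 ≤ a.im * (w.re ^ 2 + w.im ^ 2) := by positivity
  -- `n + 1` is the first exponent leaving the upper half plane, which fixes the signs. `c₁, c₂`
  -- cancel the imaginary parts; the real part left is `Im (w * conj (w * a)) = -a.im * ‖w‖ ^ 2`.
  refine ⟨n, a.im * (w.re ^ 2 + w.im ^ 2), -(w * a).im, w.im, hc0, by linarith [hsp.2], hpos.le,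
    by linarith [hsp.2], ?_⟩
  rw [hsucc, ← hw]
  apply Complex.ext <;> simp [sq] <;> ring

lemma exists_pow_convex_relation {a : ℂ} (ha : ¬ ∃ r : ℝ, 0 < r ∧ a = (r : ℂ)) :
    ∃ (n : ℕ) (c₀ c₁ c₂ : ℝ), 0 ≤ c₀ ∧ 0 ≤ c₁ ∧ 0 ≤ c₂ ∧ 0 < c₀ + c₁ + c₂ ∧
      (c₀ : ℂ) + c₁ * a ^ n + c₂ * a ^ (n + 1) = 0 := by
  rcases lt_trichotomy a.im 0 with h | h | h
  · obtain ⟨n, c₀, c₁, c₂, h0, h1, h2, hs, he⟩ :=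
      exists_pow_convex_relation_of_im_pos (a := (starRingEnd ℂ) a) (by simpa using h)
    refine ⟨n, c₀, c₁, c₂, h0, h1, h2, hs, ?_⟩
    simpa using congrArg (starRingEnd ℂ) he
  · have hre : a = (a.re : ℂ) := Complex.ext rfl (by simpa using h)
    have hle : a.re ≤ 0 := not_lt.1 fun hlt => ha ⟨a.re, hlt, hre⟩
    refine ⟨1, -a.re, 1, 0, by linarith, by simp, le_rfl, by linarith, ?_⟩
    rw [hre]; simp
  · exact exists_pow_convex_relation_of_im_pos h

/-- A convex set that contains `k`, `k a`, `k a²`, … contains `0` if `a` is not positive. -/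
lemma Convex.zero_mem_of_mul_pow_mem {s : Set ℂ} (hs : Convex ℝ s) {k a : ℂ}
    (ha : ¬ ∃ r : ℝ, 0 < r ∧ a = (r : ℂ)) (h : ∀ n : ℕ, k * a ^ n ∈ s) : (0 : ℂ) ∈ s := by
  obtain ⟨n, c₀, c₁, c₂, h0, h1, h2, hsum, he⟩ := exists_pow_convex_relation ha
  set c := c₀ + c₁ + c₂ with hc
  have hmem := hs.sum_mem (t := Finset.univ) (w := ![c₀ / c, c₁ / c, c₂ / c])
    (z := ![k * a ^ 0, k * a ^ n, k * a ^ (n + 1)])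
    (by intro i _; fin_cases i <;> simp <;> positivity)
    (by rw [Fin.sum_univ_three]; simp [← add_div, ← hc, hsum.ne'])
    (by intro i _; fin_cases i <;> exact h _)
  convert hmem using 1
  have hc0 : (c : ℂ) ≠ 0 := by exact_mod_cast hsum.ne'
  rw [Fin.sum_univ_three]
  simp only [Matrix.cons_val, Complex.real_smul, Complex.ofReal_div]
  field_simp
  linear_combination -k * he

end Powers

/-! ### Mean value property with radial weights. -/

section RadialMeanValue

/-- The mean value property for integrals against a radial weight. -/
theorem integral_radial_mul {ρ : ℝ → ℝ} (hρ : Continuous ρ) {G : ℂ → ℂ} (hG : Differentiable ℂ G)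
    (hint : Integrable fun w : ℂ => (ρ ‖w‖ : ℂ) * G w) :
    ∫ w : ℂ, (ρ ‖w‖ : ℂ) * G w = ((∫ w : ℂ, ρ ‖w‖ : ℝ) : ℂ) * G 0 := by
  have hGc := hG.continuous
  set μ : Measure ℝ := volume.restrict (Set.Ioc 0 (2 * Real.pi)) with hμ
  have hmp (θ : ℝ) : MeasurePreserving (fun w : ℂ => circleMap 0 1 θ * w) := by
    convert (rotation (Circle.exp θ)).measurePreserving using 2
    simp [circleMap]
  have hemb (θ : ℝ) : MeasurableEmbedding (fun w : ℂ => circleMap 0 1 θ * w) :=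
    (Homeomorph.mulLeft₀ (circleMap 0 1 θ) (circleMap_ne_center one_ne_zero)).measurableEmbedding
  have hnorm (θ : ℝ) (w : ℂ) : ‖circleMap 0 1 θ * w‖ = ‖w‖ := by simp
  have hrot (θ : ℝ) : ∫ w : ℂ, (ρ ‖w‖ : ℂ) * G (circleMap 0 1 θ * w) =
      ∫ w : ℂ, (ρ ‖w‖ : ℂ) * G w := by
    rw [← (hmp θ).integral_comp (hemb θ) fun w => (ρ ‖w‖ : ℂ) * G w]
    simp only [hnorm]
  have hrotn (θ : ℝ) : ∫ w : ℂ, ‖(ρ ‖w‖ : ℂ) * G (circleMap 0 1 θ * w)‖ =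
      ∫ w : ℂ, ‖(ρ ‖w‖ : ℂ) * G w‖ := by
    rw [← (hmp θ).integral_comp (hemb θ) fun w => ‖(ρ ‖w‖ : ℂ) * G w‖]
    simp only [hnorm]
  have hprod : Integrable
      (Function.uncurry fun (θ : ℝ) (w : ℂ) => (ρ ‖w‖ : ℂ) * G (circleMap 0 1 θ * w))
      (μ.prod volume) := by
    have hcont : Continuous
        (Function.uncurry fun (θ : ℝ) (w : ℂ) => (ρ ‖w‖ : ℂ) * G (circleMap 0 1 θ * w)) := by
      simp only [Function.uncurry_def, circleMap]
      fun_prop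
    rw [integrable_prod_iff hcont.aestronglyMeasurable]
    refine ⟨Filter.Eventually.of_forall fun θ => ?_, ?_⟩
    · have := (hmp θ).integrable_comp_of_integrable hint
      simpa only [Function.comp_def, hnorm, Function.uncurry_apply_pair] using this
    · simp only [Function.uncurry_apply_pair, hrotn]
      exact integrable_const _
  -- Fubini: the inner integral over `w` does not depend on `θ` by rotation invariance, while the
  -- one over `θ` is a circle mean of `G`.
  have hswap := integral_integral_swap hprod
  have hmean (w : ℂ) : ∫ θ, (ρ ‖w‖ : ℂ) * G (circleMap 0 1 θ * w) ∂μ =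
      (ρ ‖w‖ : ℂ) * ((2 * Real.pi : ℝ) * G 0) := by
    rw [integral_const_mul]
    congr 1
    have hd : Differentiable ℂ fun u : ℂ => G (u * w) := by fun_prop
    have := (hd.diffContOnCl (s := Metric.ball 0 |1|)).circleAverage
    rw [Real.circleAverage_def, intervalIntegral.integral_of_le Real.two_pi_pos.le, zero_mul,
      inv_smul_eq_iff₀ Real.two_pi_pos.ne', Complex.real_smul] at this
    exact this
  simp only [hrot, hmean] at hswap
  rw [integral_const, integral_mul_const, integral_complex_ofReal, hμ,
    measureReal_restrict_apply_univ,
    Real.volume_real_Ioc_of_le Real.two_pi_pos.le, sub_zero, Complex.real_smul] at hswap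
  have h2 : ((2 * Real.pi : ℝ) : ℂ) ≠ 0 := by exact_mod_cast Real.two_pi_pos.ne'
  apply mul_left_cancel₀ h2
  rw [hswap]; ring

end RadialMeanValue

/-! ### The Fock space: translated monomials, completeness, the operator. -/

section Fock

open ComplexConjugate

lemma integrable_fockMeasure_iff {f : ℂ → ℂ} : Integrable f fockMeasure ↔
    Integrable fun z => ((Real.pi⁻¹ * Real.exp (-‖z‖ ^ 2) : ℝ) : ℂ) * f z := by
  rw [fockMeasure, integrable_withDensity_iff_integrable_smul' (by fun_prop) (by simp)]
  refine integrable_congr (Filter.Eventually.of_forall fun z => ?_)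
  simp only [Complex.real_smul]
  rw [ENNReal.toReal_ofReal (by positivity)]

lemma integral_fockMeasure (f : ℂ → ℂ) : ∫ z, f z ∂fockMeasure =
    ∫ z, ((Real.pi⁻¹ * Real.exp (-‖z‖ ^ 2) : ℝ) : ℂ) * f z := by
  rw [fockMeasure, integral_withDensity_eq_integral_toReal_smul (by fun_prop) (by simp)]
  refine integral_congr_ae (Filter.Eventually.of_forall fun z => ?_)
  simp only [Complex.real_smul]
  rw [ENNReal.toReal_ofReal (by positivity)]

/-- The radial weight `π⁻¹ r ^ (2m) exp (-r²)`. -/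
def gaussianWeight (m : ℕ) (r : ℝ) : ℝ := r ^ (2 * m) * (Real.pi⁻¹ * Real.exp (-r ^ 2))

@[fun_prop]
lemma continuous_gaussianWeight (m : ℕ) : Continuous (gaussianWeight m) := by
  unfold gaussianWeight; fun_prop

lemma integral_gaussianWeight_pos (m : ℕ) : 0 < ∫ w : ℂ, gaussianWeight m ‖w‖ := by
  have h := Complex.integral_rpow_mul_exp_neg_rpow (p := 2) (q := (2 * m : ℕ)) (by norm_num)
    (lt_of_lt_of_le (by norm_num) (Nat.cast_nonneg _))
  have : ∀ w : ℂ, gaussianWeight m ‖w‖ = Real.pi⁻¹ *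
      (‖w‖ ^ ((2 * m : ℕ) : ℝ) * Real.exp (-‖w‖ ^ (2 : ℝ))) := fun w => by
    rw [gaussianWeight, Real.rpow_natCast, Real.rpow_two]; ring
  simp only [this]
  rw [integral_const_mul, h]
  have := Real.Gamma_pos_of_pos (s := ((2 * m : ℕ) + 2) / 2) (by positivity)
  have := Real.pi_pos
  positivity

/-- A non-integrable function has integral `0` by convention, so positivity of the integral
suffices. -/
lemma integrable_gaussianWeight (m : ℕ) : Integrable fun w : ℂ => gaussianWeight m ‖w‖ :=
  not_imp_comm.1 integral_undef (integral_gaussianWeight_pos m).ne'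

lemma ofReal_gaussianWeight (m : ℕ) (w : ℂ) : (gaussianWeight m ‖w‖ : ℂ) =
    (w * conj w) ^ m * ((Real.pi⁻¹ : ℝ) * Complex.exp (-(w * conj w))) := by
  rw [gaussianWeight, Complex.mul_conj', pow_mul]
  push_cast
  rfl

namespace FockSpace

/-- Completing the square, `|z|² - 2 Re (p̄ z) = |z - p|² - |p|²`, turns the weighted square into a
translated radial weight times `exp (|p|²)`. -/
lemma memLp_monomial (m : ℕ) (p : ℂ) :
    MemLp (fun z => (z - p) ^ m * Complex.exp (conj p * z)) 2 fockMeasure := by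
  have hc : Continuous fun z : ℂ => (z - p) ^ m * Complex.exp (conj p * z) := by fun_prop
  rw [memLp_two_iff_integrable_sq_norm hc.aestronglyMeasurable]
  suffices h : Integrable
      (fun z => (((‖(z - p) ^ m * Complex.exp (conj p * z)‖ ^ 2 : ℝ)) : ℂ)) fockMeasure from h.re
  rw [integrable_fockMeasure_iff]
  have := ((integrable_gaussianWeight m).ofReal (𝕜 := ℂ)).comp_sub_right p
  refine (this.mul_const (Complex.exp (p * conj p))).congr
    (Filter.Eventually.of_forall fun z => ?_)
  change (gaussianWeight m ‖z - p‖ : ℂ) * _ = _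
  rw [ofReal_gaussianWeight]
  push_cast
  rw [← Complex.mul_conj', ← Complex.mul_conj']
  simp only [map_mul, map_pow, map_sub, ← Complex.exp_conj, Complex.conj_conj]
  have : Complex.exp (-((z - p) * (conj z - conj p))) * Complex.exp (p * conj p) =
      Complex.exp (-(z * conj z)) * (Complex.exp (conj p * z) * Complex.exp (p * conj z)) := by
    simp only [← Complex.exp_add]
    ring_nf
  rw [mul_pow]
  linear_combination (z - p) ^ m * (conj z - conj p) ^ m * (Real.pi : ℂ)⁻¹ * this

/-- The function `(z - p) ^ m exp (p̄ z)`, a translate of a monomial. -/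
def monomial (m : ℕ) (p : ℂ) : FockSpace :=
  mk (fun z => (z - p) ^ m * Complex.exp (conj p * z)) ⟨by fun_prop, memLp_monomial m p⟩

/-- The translated monomial of degree `m` at `p` evaluates the leading coefficient of functions
that vanish to order `m` at `p`. -/
theorem inner_monomial {m : ℕ} {p : ℂ} {F : FockSpace} {g : ℂ → ℂ} (hg : Differentiable ℂ g)
    (hF : ∀ z, F z = (z - p) ^ m * g z) :
    inner ℂ (monomial m p) F = ((∫ w : ℂ, gaussianWeight m ‖w‖ : ℝ) : ℂ) * g p := by
  -- After translation by `p`, the Gaussian absorbs the conjugated exponential: a radial weight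
  -- times an entire function remains.
  have hpt : ∀ w : ℂ, ((Real.pi⁻¹ * Real.exp (-‖w + p‖ ^ 2) : ℝ) : ℂ) *
      (F (w + p) * conj (monomial m p (w + p))) =
      (gaussianWeight m ‖w‖ : ℂ) * (g (w + p) * Complex.exp (-(conj p * w))) := by
    intro w
    rw [ofReal_gaussianWeight, hF]
    simp only [monomial, mk_apply]
    push_cast
    rw [← Complex.mul_conj']
    simp only [map_mul, map_pow, map_add, ← Complex.exp_conj, Complex.conj_conj,
      add_sub_cancel_right]
    have : Complex.exp (-((w + p) * (conj w + conj p))) * Complex.exp (p * (conj w + conj p)) =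
        Complex.exp (-(w * conj w)) * Complex.exp (-(conj p * w)) := by
      simp only [← Complex.exp_add]
      ring_nf
    linear_combination (Real.pi : ℂ)⁻¹ * (w * conj w) ^ m * g (w + p) * this
  have hint := (integrable_fockMeasure_iff.1 (integrable_inner (monomial m p) F)).comp_add_right p
  simp only [hpt] at hint
  rw [inner_def, integral_fockMeasure, ← integral_add_right_eq_self _ p]
  simp only [hpt]
  rw [integral_radial_mul (continuous_gaussianWeight m) (by fun_prop) hint]
  simp

lemma inner_monomial_self (m : ℕ) (p : ℂ) : inner ℂ (monomial m p) (monomial m p) =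
    ((∫ w : ℂ, gaussianWeight m ‖w‖ : ℝ) : ℂ) * Complex.exp (conj p * p) :=
  inner_monomial (g := fun z => Complex.exp (conj p * z)) (by fun_prop) fun _ => rfl

lemma monomial_ne_zero (m : ℕ) (p : ℂ) : monomial m p ≠ 0 := by
  rw [← inner_self_ne_zero (𝕜 := ℂ), inner_monomial_self]
  exact mul_ne_zero (by exact_mod_cast (integral_gaussianWeight_pos m).ne') (Complex.exp_ne_zero _)

lemma norm_sq_monomial (m : ℕ) (p : ℂ) :
    ‖monomial m p‖ ^ 2 = (∫ w : ℂ, gaussianWeight m ‖w‖) * Real.exp (‖p‖ ^ 2) := by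
  have := inner_monomial_self m p
  rw [inner_self_eq_ofReal_norm_sq, mul_comm _ p, Complex.mul_conj'] at this
  exact_mod_cast this

/-- Point evaluations are bounded, locally uniformly. -/
lemma exists_norm_apply_le (R : ℝ) :
    ∃ C : ℝ, 0 ≤ C ∧ ∀ (f : FockSpace) (z : ℂ), ‖z‖ ≤ R → ‖f z‖ ≤ C * ‖f‖ := by
  set c := ∫ w : ℂ, gaussianWeight 0 ‖w‖ with hc
  have hcpos : 0 < c := integral_gaussianWeight_pos 0
  refine ⟨c⁻¹ * √(c * Real.exp (R ^ 2)), by positivity, fun f z hz => ?_⟩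
  -- For `m = 0` the monomial is the reproducing kernel at `z`, up to the constant `c`.
  have h1 := inner_monomial (m := 0) (p := z) (F := f) f.differentiable fun _ => by simp
  have h2 : ‖monomial 0 z‖ ≤ √(c * Real.exp (R ^ 2)) := by
    refine Real.le_sqrt_of_sq_le ?_
    rw [norm_sq_monomial]
    gcongr
  have h3 := norm_inner_le_norm (𝕜 := ℂ) (monomial 0 z) f
  rw [h1, norm_mul, Complex.norm_real, Real.norm_of_nonneg hcpos.le] at h3
  rw [mul_assoc, ← div_eq_inv_mul, le_div_iff₀' hcpos]
  exact h3.trans (by gcongr)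

/-- The embedding of the Fock space in `L²`. -/
def toL2 : FockSpace →ₗᵢ[ℂ] Lp ℂ 2 fockMeasure where
  toFun f := f.memLp.toLp
  map_add' f g := MemLp.toLp_add f.memLp g.memLp
  map_smul' c f := MemLp.toLp_const_smul c f.memLp
  norm_map' f := by
    have h : inner ℂ (f.memLp.toLp) (f.memLp.toLp) = inner ℂ f f := by
      rw [L2.inner_def, inner_def]
      refine integral_congr_ae ?_
      filter_upwards [f.memLp.coeFn_toLp] with z hz
      rw [hz]; rfl
    rw [inner_self_eq_ofReal_norm_sq, inner_self_eq_ofReal_norm_sq] at h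
    have h' : ‖f.memLp.toLp‖ ^ 2 = ‖f‖ ^ 2 := by exact_mod_cast h
    exact (pow_left_inj₀ (norm_nonneg _) (norm_nonneg _) two_ne_zero).1 h'

lemma uniformCauchySeqOn_closedBall {u : ℕ → FockSpace} (hu : CauchySeq u) (R : ℝ) :
    UniformCauchySeqOn (fun n z => u n z) Filter.atTop (Metric.closedBall 0 R) := by
  obtain ⟨C, hC, h⟩ := exists_norm_apply_le R
  rw [Metric.uniformCauchySeqOn_iff]
  intro ε hε
  -- `C + 1` because `C` may be zero.
  obtain ⟨N, hN⟩ := Metric.cauchySeq_iff.1 hu (ε / (C + 1)) (by positivity)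
  refine ⟨N, fun m hm n hn z hz => ?_⟩
  have hlt := hN m hm n hn
  rw [dist_eq_norm, lt_div_iff₀' (by positivity)] at hlt
  have happ : u m z - u n z = (u m - u n) z := rfl
  rw [dist_eq_norm, happ]
  have hle := h (u m - u n) z (by simpa using hz)
  nlinarith [norm_nonneg (u m - u n)]

lemma exists_tendstoLocallyUniformly {u : ℕ → FockSpace} (hu : CauchySeq u) :
    ∃ F : ℂ → ℂ, TendstoLocallyUniformly (fun n z => u n z) F Filter.atTop := by
  have hc : ∀ z, ∃ l, Filter.Tendsto (fun n => u n z) Filter.atTop (nhds l) := fun z =>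
    cauchySeq_tendsto_of_complete
      ((uniformCauchySeqOn_closedBall hu ‖z‖).cauchySeq (x := z) (by simp))
  choose F hF using hc
  refine ⟨F, tendstoLocallyUniformly_of_forall_exists_nhds fun z =>
    ⟨Metric.closedBall 0 (‖z‖ + 1), ?_, ?_⟩⟩
  · exact Filter.mem_of_superset (Metric.ball_mem_nhds z one_pos) fun w hw => by
      rw [mem_closedBall_zero_iff]
      rw [Metric.mem_ball, dist_eq_norm] at hw
      linarith [norm_le_norm_add_norm_sub' w z]
  · exact (uniformCauchySeqOn_closedBall hu _).tendstoUniformlyOn_of_tendsto fun w _ => hF w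

instance : CompleteSpace FockSpace := by
  refine Metric.complete_of_cauchySeq_tendsto fun u hu => ?_
  obtain ⟨F, hF⟩ := exists_tendstoLocallyUniformly hu
  have hFd : Differentiable ℂ F := by
    rw [← differentiableOn_univ]
    rw [← tendstoLocallyUniformlyOn_univ] at hF
    exact hF.differentiableOn
      (Filter.Eventually.of_forall fun n => (u n).differentiable.differentiableOn) isOpen_univ
  obtain ⟨G, hG⟩ := cauchySeq_tendsto_of_complete (toL2.isometry.uniformContinuous.comp_cauchySeq hu)
  -- An a.e. convergent subsequence identifies the `L²` limit with the entire locally uniform limit.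
  have hFG : G =ᵐ[fockMeasure] F := by
    obtain ⟨ns, hns, hlim⟩ := (tendstoInMeasure_of_tendsto_Lp hG).exists_seq_tendsto_ae
    have hall : ∀ᵐ z ∂fockMeasure, ∀ n, toL2 (u n) z = u n z :=
      ae_all_iff.2 fun n => (u n).memLp.coeFn_toLp
    filter_upwards [hlim, hall] with z hz hall
    simp only [Function.comp_apply, hall] at hz
    have hp : Filter.Tendsto (fun n => u n z) Filter.atTop (nhds (F z)) := 
      hF.tendstoLocallyUniformlyOn.tendsto_at (Set.mem_univ z)
    exact tendsto_nhds_unique hz (hp.comp hns.tendsto_atTop)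
  have hFm : MemLp F 2 fockMeasure := (memLp_congr_ae hFG).1 (Lp.memLp G)
  refine ⟨mk F ⟨hFd, hFm⟩, ?_⟩
  have hGF : G = toL2 (mk F ⟨hFd, hFm⟩) :=
    Lp.ext (hFG.trans (mk F ⟨hFd, hFm⟩).memLp.coeFn_toLp.symm)
  rw [hGF] at hG
  exact toL2.isometry.isEmbedding.tendsto_nhds_iff.2 hG

end FockSpace

/-- Since `φ z - p = a * (z - p)`, the image has a zero of order at least `m` at `p`, and the
cofactor `a ^ m * ψ z * exp (p̄ φ z)` is evaluated at `p`. -/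
lemma inner_monomial_weightedComp {ψ : ℂ → ℂ} (hψ : Differentiable ℂ ψ) {a b p : ℂ}
    (hp : a * p + b = p) (hm : MapsFock ψ (fun z => a * z + b)) (m : ℕ) :
    inner ℂ (FockSpace.monomial m p)
      (weightedComp ψ (fun z => a * z + b) hm (FockSpace.monomial m p)) =
      ψ p * a ^ m * inner ℂ (FockSpace.monomial m p) (FockSpace.monomial m p) := by
  rw [FockSpace.inner_monomial_self, FockSpace.inner_monomial
    (g := fun z => a ^ m * ψ z * Complex.exp (conj p * (a * z + b))) (by fun_prop) ?_]
  · simp only [hp]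
    ring
  · intro z
    have : a * z + b - p = a * (z - p) := by linear_combination hp
    change ψ z * ((a * z + b - p) ^ m * Complex.exp (conj p * (a * z + b))) = _
    rw [this, mul_pow]
    ring

lemma mul_pow_mem_numericalRange_weightedComp {ψ : ℂ → ℂ} (hψ : Differentiable ℂ ψ) {a b p : ℂ}
    (hp : a * p + b = p) (hm : MapsFock ψ (fun z => a * z + b)) (m : ℕ) :
    ψ p * a ^ m ∈ numericalRange (weightedComp ψ (fun z => a * z + b) hm) := by
  have hne := FockSpace.monomial_ne_zero m p
  have h := inner_map_div_norm_sq_mem_numericalRange (weightedComp ψ (fun z => a * z + b) hm) hne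
  rwa [inner_monomial_weightedComp hψ hp, ← inner_self_eq_ofReal_norm_sq,
    mul_div_cancel_right₀ _ (inner_self_ne_zero.2 hne)] at h

end Fock
end

theorem theorem2p2 (ψ : ℂ → ℂ) (hψ : Differentiable ℂ ψ) (a b : ℂ)
    (ha0 : 0 < ‖a‖) (ha1 : ‖a‖ < 1)
    (hψp : ψ (b / (1 - a)) ≠ 0)
    (hm : MapsFock ψ (fun z => a * z + b))
    (hcpt : IsCompactOperator (weightedComp ψ (fun z => a * z + b) hm))
    (ha : ¬ ∃ r : ℝ, 0 < r ∧ a = (r : ℂ)) :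
    (0 : ℂ) ∈ numericalRange (weightedComp ψ (fun z => a * z + b) hm) ∧
      IsClosed (numericalRange (weightedComp ψ (fun z => a * z + b) hm)) := by
  have h1 : 1 - a ≠ 0 := sub_ne_zero.2 fun h => ha ⟨1, one_pos, by simp [← h]⟩
  have hp : a * (b / (1 - a)) + b = b / (1 - a) := by field_simp; ring
  have h0 := (convex_numericalRange _).zero_mem_of_mul_pow_mem ha
    (mul_pow_mem_numericalRange_weightedComp hψ hp hm)
  exact ⟨h0, hcpt.isClosed_numericalRange h0⟩
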